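/- Let $m_A,m_B$ be numbers of two-outcome measurements (outcomes $0,1$) of Alice and Bob. For a box $P=\big(P(a,b\mid i,j)\big)$ with $a,b\in\{0,1\}$, $1\le i\le m_A$, $1\le j\le m_B$, put $\langle A_iB_j\rangle=\sum_{a,b}(-1)^{a+b}P(a,b\mid i,j)$. A box is no-signalling if it is non-negative and normalized and each party's marginals do not depend on the other party's input; the classical boxes are the convex combinations of the $\{0,1\}$-valued no-signalling boxes; the quantum boxes are those of the form $P(a,b\mid i,j)=\operatorname{Tr}\big[\rho\,(E^A_{i,a}\otimes E^B_{j,b})\big]$ with a state $\rho$ on a tensor product of two finite-dimensional Hilbert spaces (of any dimensions) and projective measurements $\{E^A_{i,a}\}_a$, $\{E^B_{j,b}\}_b$. Let $\mathcal C,\mathcal Q,\mathcal N\subseteq\mathbb R^{m_A m_B}$ be the sets of vectors $(\langle A_iB_j\rangle)_{i,j}$ of classical, quantum and no-signalling boxes, respectively. Thus $\mathcal C$ is the two-party binary-outcome correlation polytope (the cut polytope of the complete bipartite graph $K_{m_A,m_B}$ in $\pm1$ coordinates), and $\mathcal N$ is the cube $[-1,1]^{m_A m_B}$. An inequality is facet-defining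 for a polytope if it is valid on it and the set of points of the polytope at which it holds with equality is non-empty and has dimension one less than the polytope. Let $\sum_{i,j}\alpha_{ij}\langle A_iB_j\rangle\le\beta_c$ be a facet-defining inequality of $\mathcal C$ that is not also a facet-defining inequality of $\mathcal N$ (i.e. it is not a positive multiple of one of the trivial inequalities $\pm\langle A_iB_j\rangle\le 1$). Then its quantum value $\beta_q=\sup_{x\in\mathcal Q}\sum_{i,j}\alpha_{ij}x_{ij}$ is finite and strictly larger than $\beta_c$. -/

import Mathlib

open scoped Kronecker ComplexOrder

namespace BellCorr

/-- A box of the scenario with `mA`, `mB` inputs and two outputs per measurement: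
`P i j a b` stands for the probability `P(a, b | i, j)` of the outputs `a`, `b`
given the inputs `i` (Alice) and `j` (Bob). -/
abbrev Box (mA mB : ℕ) : Type := Fin mA → Fin mB → Fin 2 → Fin 2 → ℝ

/-- The no-signalling boxes: non-negative, normalized, and such that the marginals of each party
do not depend on the input of the other one. -/
def noSignallingSet (mA mB : ℕ) : Set (Box mA mB) :=
  {P | (∀ i j a b, 0 ≤ P i j a b) ∧
    (∀ i j, ∑ a, ∑ b, P i j a b = 1) ∧
    (∀ i i' j b, ∑ a, P i j a b = ∑ a, P i' j a b) ∧
    (∀ i j j' a, ∑ b, P i j a b = ∑ b, P i j' a b)}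

/-- The local deterministic boxes: the no-signalling boxes with all entries in `{0, 1}`. -/
def localDeterministicBoxes (mA mB : ℕ) : Set (Box mA mB) :=
  {P | P ∈ noSignallingSet mA mB ∧ ∀ i j a b, P i j a b = 0 ∨ P i j a b = 1}

/-- The classical (Bell) polytope. -/
def classicalPolytope (mA mB : ℕ) : Set (Box mA mB) :=
  convexHull ℝ (localDeterministicBoxes mA mB)

/-- A two-outcome projective measurement on `ℂ ^ d`: Hermitian, mutually orthogonal idempotents
that sum to the identity. -/
structure IsProjectiveMeasurement {d : ℕ} (E : Fin 2 → Matrix (Fin d) (Fin d) ℂ) : Prop where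
  isHermitian : ∀ a, (E a).IsHermitian
  mul_eq : ∀ a a', E a * E a' = if a = a' then E a else 0
  sum_eq_one : ∑ a, E a = 1

/-- The quantum boxes: `P(a, b | i, j) = Tr (ρ (E i a ⊗ F j b))` for a state `ρ` on
`ℂ ^ dA ⊗ ℂ ^ dB` (of arbitrary dimensions) and projective measurements `E i`, `F j`. -/
def quantumSet (mA mB : ℕ) : Set (Box mA mB) :=
  {P | ∃ (dA dB : ℕ) (ρ : Matrix (Fin dA × Fin dB) (Fin dA × Fin dB) ℂ)
      (E : Fin mA → Fin 2 → Matrix (Fin dA) (Fin dA) ℂ)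
      (F : Fin mB → Fin 2 → Matrix (Fin dB) (Fin dB) ℂ),
      ρ.PosSemidef ∧ ρ.trace = 1 ∧
      (∀ i, IsProjectiveMeasurement (E i)) ∧ (∀ j, IsProjectiveMeasurement (F j)) ∧
      ∀ i j a b, ((P i j a b : ℝ) : ℂ) = (ρ * (E i a ⊗ₖ F j b)).trace}

/-- The correlators `⟨A_i B_j⟩ = P(a ⊕ b = 0 | i, j) - P(a ⊕ b = 1 | i, j)` of a box. -/
def correlators {mA mB : ℕ} (P : Box mA mB) : Fin mA → Fin mB → ℝ :=
  fun i j => ∑ a : Fin 2, ∑ b : Fin 2, (-1 : ℝ) ^ ((a : ℕ) + (b : ℕ)) * P i j a b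

/-- The binary-outcome correlation polytope: the correlators of classical boxes. -/
def correlationPolytope (mA mB : ℕ) : Set (Fin mA → Fin mB → ℝ) :=
  correlators '' classicalPolytope mA mB

/-- The correlators of no-signalling boxes. -/
def noSignallingCorrelations (mA mB : ℕ) : Set (Fin mA → Fin mB → ℝ) :=
  correlators '' noSignallingSet mA mB

/-- The correlators of quantum boxes. -/
def quantumCorrelations (mA mB : ℕ) : Set (Fin mA → Fin mB → ℝ) :=
  correlators '' quantumSet mA mB

/-- The correlation Bell expression `∑ i j, α i j * ⟨A_i B_j⟩`. -/
def bellValue {mA mB : ℕ} (α x : Fin mA → Fin mB → ℝ) : ℝ :=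
  ∑ i, ∑ j, α i j * x i j

/-- The dimension of the affine hull of a non-empty set. -/
noncomputable def affineDim {mA mB : ℕ} (S : Set (Fin mA → Fin mB → ℝ)) : ℕ :=
  Module.finrank ℝ (affineSpan ℝ S).direction

/-- The points of `K` at which the inequality `bellValue α x ≤ β` is an equality. -/
def face {mA mB : ℕ} (K : Set (Fin mA → Fin mB → ℝ)) (α : Fin mA → Fin mB → ℝ) (β : ℝ) :
    Set (Fin mA → Fin mB → ℝ) :=
  {x | x ∈ K ∧ bellValue α x = β}

/-- The inequality `bellValue α x ≤ β` is valid on `K` and supports a facet of `K`, that is, a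
non-empty face whose dimension is one less than the dimension of `K`. -/
def IsFacetDefining {mA mB : ℕ} (K : Set (Fin mA → Fin mB → ℝ)) (α : Fin mA → Fin mB → ℝ)
    (β : ℝ) : Prop :=
  (∀ x ∈ K, bellValue α x ≤ β) ∧ (face K α β).Nonempty ∧
    affineDim (face K α β) + 1 = affineDim K

/-- The values that a Bell expression takes on quantum correlations. -/
def quantumValues {mA mB : ℕ} (α : Fin mA → Fin mB → ℝ) : Set ℝ :=
  bellValue α '' quantumCorrelations mA mB

end BellCorr

namespace BellCorr

open Matrix

variable {mA mB : ℕ}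

/-! Suppose quantum correlations never exceed `βc`. For Alice's signs `a` put `s_j(a) = ∑ i, α i j *
a i`; Bob's best reply gives `∑ j, |s_j(a)| ≤ βc`, with equality at tight deterministic points. If
`a`, `a'` both occur in tight points, giving Alice the unit vectors `(a i, a' i)/√2` and Bob the
optimal unit vectors yields the quantum value `∑ j, √((s_j(a)² + s_j(a')²)/2)`. It dominates the sum
of the means `(|s_j(a)| + |s_j(a')|)/2`, which is already `βc`, so `|s_j(a)| = |s_j(a')|` for every
`j` (`exists_column_multipliers`). Hence `s_j(a) = l j * b j` at all tight points.

A facet has `βc ≠ 0`, so its tight points span the whole space and any linear relation among their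
coordinates is trivial (`IsFacetDefining.eq_zero`). Applied to the relations above, this leaves `α`
a single nonzero column (`column_unique`), then a single nonzero entry (`row_unique`). Such an
inequality is a facet of the no-signalling cube (`of_single_entry`), which is excluded. -/

/-- The vectors with entries `±1`. -/
def IsSign {n : ℕ} (a : Fin n → ℝ) : Prop := ∀ i, a i = 1 ∨ a i = -1

/-- The correlators `a i * b j` of deterministic strategies. -/
def signPoints (mA mB : ℕ) : Set (Fin mA → Fin mB → ℝ) :=
  {x | ∃ a b, IsSign a ∧ IsSign b ∧ x = fun i j => a i * b j}

/-- The map `correlators` as a linear map. -/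
def correlatorsLin (mA mB : ℕ) : Box mA mB →ₗ[ℝ] (Fin mA → Fin mB → ℝ) where
  toFun := correlators
  map_add' P P' := by
    ext i j
    simp only [correlators, Pi.add_apply, mul_add, Finset.sum_add_distrib]
  map_smul' c P := by
    ext i j
    simp only [correlators, Pi.smul_apply, smul_eq_mul, RingHom.id_apply, Finset.mul_sum]
    exact Finset.sum_congr rfl fun _ _ => Finset.sum_congr rfl fun _ _ => by ring

/-- The Bell expression as a linear functional. -/
def bellLin (α : Fin mA → Fin mB → ℝ) : (Fin mA → Fin mB → ℝ) →ₗ[ℝ] ℝ where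
  toFun := bellValue α
  map_add' x y := by
    simp only [bellValue, Pi.add_apply, mul_add, Finset.sum_add_distrib]
  map_smul' c x := by
    simp only [bellValue, Pi.smul_apply, smul_eq_mul, RingHom.id_apply, Finset.mul_sum]
    exact Finset.sum_congr rfl fun _ _ => Finset.sum_congr rfl fun _ _ => by ring

@[simp] theorem bellLin_apply (α x : Fin mA → Fin mB → ℝ) : bellLin α x = bellValue α x := rfl

theorem IsSign.mul_self {n : ℕ} {a : Fin n → ℝ} (ha : IsSign a) (i : Fin n) : a i * a i = 1 := by
  rcases ha i with h | h <;> simp [h]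

theorem IsSign.neg {n : ℕ} {a : Fin n → ℝ} (ha : IsSign a) : IsSign fun i => -a i := fun i => by
  rcases ha i with h | h <;> simp [h]

/-! ### Classical correlations -/

/-- The product box with expectation values `a i` and `b j`. -/
noncomputable def productBox (a : Fin mA → ℝ) (b : Fin mB → ℝ) : Box mA mB :=
  fun i j x y => (1 + (-1) ^ (x : ℕ) * a i) / 2 * ((1 + (-1) ^ (y : ℕ) * b j) / 2)

theorem correlators_productBox (a : Fin mA → ℝ) (b : Fin mB → ℝ) :
    correlators (productBox a b) = fun i j => a i * b j := by
  ext i j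
  simp [correlators, productBox, Fin.sum_univ_two]
  ring

theorem productBox_mem_localDeterministicBoxes {a : Fin mA → ℝ} {b : Fin mB → ℝ}
    (ha : IsSign a) (hb : IsSign b) : productBox a b ∈ localDeterministicBoxes mA mB := by
  have h01 : ∀ i j x y, productBox a b i j x y = 0 ∨ productBox a b i j x y = 1 := by
    intro i j x y
    fin_cases x <;> fin_cases y <;> rcases ha i with h | h <;> rcases hb j with h' | h' <;>
      norm_num [productBox, h, h']
  refine ⟨⟨fun i j x y => ?_, fun i j => ?_, fun i i' j y => ?_, fun i j j' x => ?_⟩, h01⟩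
  · rcases h01 i j x y with h | h <;> simp [h]
  all_goals
    simp [productBox, Fin.sum_univ_two]
    ring

theorem correlators_apply_eq_mul {P : Box mA mB} (hP : P ∈ localDeterministicBoxes mA mB)
    (i : Fin mA) (j : Fin mB) :
    let p := ∑ y, P i j 0 y - ∑ y, P i j 1 y
    let q := ∑ x, P i j x 0 - ∑ x, P i j x 1
    (p = 1 ∨ p = -1) ∧ (q = 1 ∨ q = -1) ∧ correlators P i j = p * q := by
  obtain ⟨⟨-, hsum, -, -⟩, h01⟩ := hP
  have hs := hsum i j
  simp only [Fin.sum_univ_two] at hs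
  simp only [correlators, Fin.sum_univ_two]
  rcases h01 i j 0 0 with h1 | h1 <;> rcases h01 i j 0 1 with h2 | h2 <;>
    rcases h01 i j 1 0 with h3 | h3 <;> rcases h01 i j 1 1 with h4 | h4 <;>
    rw [h1, h2, h3, h4] at hs ⊢ <;> first | (norm_num at hs; done) | norm_num

theorem correlators_mem_signPoints {P : Box mA mB} (hP : P ∈ localDeterministicBoxes mA mB) :
    correlators P ∈ signPoints mA mB := by
  rcases isEmpty_or_nonempty (Fin mA) with hA | ⟨⟨i₀⟩⟩
  · exact ⟨fun _ => 1, fun _ => 1, fun _ => .inl rfl, fun _ => .inl rfl,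
      funext fun i => (hA.false i).elim⟩
  rcases isEmpty_or_nonempty (Fin mB) with hB | ⟨⟨j₀⟩⟩
  · exact ⟨fun _ => 1, fun _ => 1, fun _ => .inl rfl, fun _ => .inl rfl,
      funext fun i => funext fun j => (hB.false j).elim⟩
  -- Each party's sign is read off its marginal at a fixed input of the other; no-signalling makes
  -- that choice immaterial.
  refine ⟨fun i => ∑ y, P i j₀ 0 y - ∑ y, P i j₀ 1 y, fun j => ∑ x, P i₀ j x 0 - ∑ x, P i₀ j x 1,
    fun i => (correlators_apply_eq_mul hP i j₀).1, fun j => (correlators_apply_eq_mul hP i₀ j).2.1,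
    ?_⟩
  obtain ⟨⟨-, -, hB, hA⟩, -⟩ := id hP
  ext i j
  rw [(correlators_apply_eq_mul hP i j).2.2, hA i j j₀ 0, hA i j j₀ 1, hB i i₀ j 0, hB i i₀ j 1]

theorem correlators_image_localDeterministicBoxes :
    correlators '' localDeterministicBoxes mA mB = signPoints mA mB := by
  ext x
  constructor
  · rintro ⟨P, hP, rfl⟩
    exact correlators_mem_signPoints hP
  · rintro ⟨a, b, ha, hb, rfl⟩
    exact ⟨_, productBox_mem_localDeterministicBoxes ha hb, correlators_productBox a b⟩

theorem correlationPolytope_eq :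
    correlationPolytope mA mB = convexHull ℝ (signPoints mA mB) := by
  rw [← correlators_image_localDeterministicBoxes]
  exact (correlatorsLin mA mB).image_convexHull _

theorem signPoints_subset : signPoints mA mB ⊆ correlationPolytope mA mB := by
  rw [correlationPolytope_eq]
  exact subset_convexHull ℝ _

theorem convex_noSignallingSet : Convex ℝ (noSignallingSet mA mB) := by
  rintro P ⟨h1, h2, h3, h4⟩ P' ⟨h1', h2', h3', h4'⟩ s t hs ht hst
  refine ⟨fun i j a b => ?_, fun i j => ?_, fun i i' j b => ?_, fun i j j' a => ?_⟩ <;>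
    simp only [Pi.add_apply, Pi.smul_apply, smul_eq_mul, Finset.sum_add_distrib, ← Finset.mul_sum]
  · exact add_nonneg (mul_nonneg hs (h1 ..)) (mul_nonneg ht (h1' ..))
  · rw [h2, h2', mul_one, mul_one, hst]
  · rw [h3 i i', h3' i i']
  · rw [h4 i j j', h4' i j j']

theorem correlationPolytope_subset :
    correlationPolytope mA mB ⊆ noSignallingCorrelations mA mB :=
  Set.image_mono (convexHull_min (fun _ hP => hP.1) convex_noSignallingSet)

theorem abs_correlators_le_one {P : Box mA mB} {i : Fin mA} {j : Fin mB}
    (h0 : ∀ a b, 0 ≤ P i j a b) (h1 : ∑ a, ∑ b, P i j a b = 1) : |correlators P i j| ≤ 1 := by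
  have h00 := h0 0 0
  have h01 := h0 0 1
  have h10 := h0 1 0
  have h11 := h0 1 1
  simp only [correlators, Fin.sum_univ_two] at h1 ⊢
  norm_num at h1 ⊢
  rw [abs_le]
  constructor <;> linarith

/-! ### Quantum correlations -/

theorem quantumSet_nonneg_and_sum_eq_one {P : Box mA mB} (hP : P ∈ quantumSet mA mB)
    (i : Fin mA) (j : Fin mB) : (∀ a b, 0 ≤ P i j a b) ∧ ∑ a, ∑ b, P i j a b = 1 := by
  obtain ⟨dA, dB, ρ, E, F, hρ, htr, hE, hF, hPE⟩ := hP
  constructor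
  · intro a b
    -- Since `G` is a projection, `Tr (ρ G) = Tr (G ρ Gᴴ)`, the trace of a positive semidefinite
    -- matrix.
    have hG : E i a ⊗ₖ F j b = (E i a ⊗ₖ F j b)ᴴ * (E i a ⊗ₖ F j b) := by
      rw [conjTranspose_kronecker, ← mul_kronecker_mul, ((hE i).isHermitian a).eq,
        ((hF j).isHermitian b).eq, (hE i).mul_eq, (hF j).mul_eq, if_pos rfl, if_pos rfl]
    have h : (0 : ℂ) ≤ (P i j a b : ℝ) := by
      rw [hPE, hG, ← Matrix.mul_assoc, trace_mul_comm, ← Matrix.mul_assoc]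
      exact (hρ.mul_mul_conjTranspose_same _).trace_nonneg
    exact_mod_cast h
  · have h : ((∑ a, ∑ b, P i j a b : ℝ) : ℂ) = 1 := by
      have hone : ∑ a, ∑ b, E i a ⊗ₖ F j b = 1 := by
        rw [← one_kronecker_one, ← (hE i).sum_eq_one, ← (hF j).sum_eq_one]
        simp only [Fin.sum_univ_two, add_kronecker, kronecker_add]
        abel
      push_cast
      simp only [hPE, ← trace_sum, ← Matrix.mul_sum, hone, Matrix.mul_one, htr]
    exact_mod_cast h

theorem bddAbove_quantumValues (α : Fin mA → Fin mB → ℝ) : BddAbove (quantumValues α) := by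
  refine ⟨∑ i, ∑ j, |α i j|, ?_⟩
  rintro _ ⟨_, ⟨P, hP, rfl⟩, rfl⟩
  refine Finset.sum_le_sum fun i _ => Finset.sum_le_sum fun j _ => ?_
  obtain ⟨h0, h1⟩ := quantumSet_nonneg_and_sum_eq_one hP i j
  calc α i j * correlators P i j ≤ |α i j| * |correlators P i j| :=
        (le_abs_self _).trans (abs_mul _ _).le
    _ ≤ |α i j| := mul_le_of_le_one_right (abs_nonneg _) (abs_correlators_le_one h0 h1)

/-- The spectral projections of the reflection `p σ_z + q σ_x`. -/
noncomputable def qubitProj (p q : ℝ) (a : Fin 2) : Matrix (Fin 2) (Fin 2) ℂ :=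
  !![(1 + (-1) ^ (a : ℕ) * (p : ℂ)) / 2, (-1) ^ (a : ℕ) * (q : ℂ) / 2;
    (-1) ^ (a : ℕ) * (q : ℂ) / 2, (1 - (-1) ^ (a : ℕ) * (p : ℂ)) / 2]

theorem isProjectiveMeasurement_qubitProj {p q : ℝ} (h : p * p + q * q = 1) :
    IsProjectiveMeasurement (qubitProj p q) where
  isHermitian a := by
    ext x y
    fin_cases a <;> fin_cases x <;> fin_cases y <;> simp [qubitProj]
  mul_eq a a' := by
    have h' : (p : ℂ) * p + q * q = 1 := by exact_mod_cast h
    ext x y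
    fin_cases a <;> fin_cases a' <;> fin_cases x <;> fin_cases y <;>
      simp [qubitProj, Matrix.mul_apply, Fin.sum_univ_two] <;>
      first | ring1 | linear_combination (1 / 4 : ℂ) * h' | linear_combination (-1 / 4 : ℂ) * h'
  sum_eq_one := by
    ext x y
    fin_cases x <;> fin_cases y <;> simp [qubitProj, Fin.sum_univ_two] <;> ring

/-- The maximally entangled state vector of two qubits, up to normalization. -/
def bellVector : Fin 2 × Fin 2 → ℂ := fun x => if x.1 = x.2 then 1 else 0

/-- Tsirelson's construction for plane vectors: on the maximally entangled state, real symmetric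
`A`, `B` have correlation `Tr (A B) / 2`, which for the reflections `u σ_z + u' σ_x` and `v σ_z + v'
σ_x` is the inner product. The marginals are uniform, whence the formula for `P`. -/
theorem inner_mem_quantumCorrelations {u u' : Fin mA → ℝ} {v v' : Fin mB → ℝ}
    (hu : ∀ i, u i * u i + u' i * u' i = 1) (hv : ∀ j, v j * v j + v' j * v' j = 1) :
    (fun i j => u i * v j + u' i * v' j) ∈ quantumCorrelations mA mB := by
  set ρ : Matrix (Fin 2 × Fin 2) (Fin 2 × Fin 2) ℂ :=
    (1 / 2 : ℂ) • vecMulVec bellVector (star bellVector) with hρ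
  let P : Box mA mB := fun i j a b =>
    (1 + (-1) ^ ((a : ℕ) + (b : ℕ)) * (u i * v j + u' i * v' j)) / 4
  refine ⟨P, ⟨2, 2, ρ, fun i => qubitProj (u i) (u' i), fun j => qubitProj (v j) (v' j), ?_, ?_,
    fun i => isProjectiveMeasurement_qubitProj (hu i),
    fun j => isProjectiveMeasurement_qubitProj (hv j), ?_⟩, ?_⟩
  · exact (posSemidef_vecMulVec_self_star bellVector).smul (by
      rw [Complex.le_def]; norm_num)
  · simp [hρ, Matrix.trace, Fintype.sum_prod_type, vecMulVec_apply, bellVector]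
  · intro i j a b
    fin_cases a <;> fin_cases b <;>
    · simp [P, hρ, Matrix.trace, Fintype.sum_prod_type, vecMulVec_apply, bellVector,
        Fin.sum_univ_two, Matrix.mul_apply, qubitProj]
      ring
  · ext i j
    simp [correlators, P, Fin.sum_univ_two]
    ring

/-! ### Facets of the correlation polytope -/

/-- Flipping one sign of the all-ones vector changes it by twice a basis vector; the product of two
such differences is four times a matrix unit. -/
theorem single_eq_of_signs (i₀ : Fin mA) (j₀ : Fin mB) :
    ∃ a a' : Fin mA → ℝ, ∃ b b' : Fin mB → ℝ, IsSign a ∧ IsSign a' ∧ IsSign b ∧ IsSign b' ∧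
      (Pi.single i₀ (Pi.single j₀ 1) : Fin mA → Fin mB → ℝ) =
        (1 / 4 : ℝ) • (((fun i j => a i * b j) - fun i j => a' i * b j) -
          ((fun i j => a i * b' j) - fun i j => a' i * b' j)) := by
  refine ⟨fun _ => 1, fun i => if i = i₀ then -1 else 1, fun _ => 1,
    fun j => if j = j₀ then -1 else 1, fun _ => .inl rfl, fun i => ?_, fun _ => .inl rfl,
    fun j => ?_, ?_⟩
  · by_cases h : i = i₀ <;> simp [h]
  · by_cases h : j = j₀ <;> simp [h]
  · ext i j
    by_cases h : i = i₀
    · subst h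
      by_cases h' : j = j₀
      · subst h'
        norm_num
      · simp [h']
    · by_cases h' : j = j₀ <;> simp [h, h']

theorem eq_top_of_single_mem {S : Submodule ℝ (Fin mA → Fin mB → ℝ)}
    (h : ∀ i j, Pi.single i (Pi.single j 1) ∈ S) : S = ⊤ := by
  rw [eq_top_iff]
  rintro x -
  have hx : x = ∑ i, ∑ j, x i j • (Pi.single i (Pi.single j 1) : Fin mA → Fin mB → ℝ) := by
    ext k l
    simp [Finset.sum_apply, Pi.single_apply, apply_ite, ite_apply]
  rw [hx]
  exact S.sum_mem fun i _ => S.sum_mem fun j _ => S.smul_mem _ (h i j)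

theorem direction_affineSpan_correlationPolytope :
    (affineSpan ℝ (correlationPolytope mA mB)).direction = ⊤ := by
  refine eq_top_of_single_mem fun i j => ?_
  obtain ⟨a, a', b, b', ha, ha', hb, hb', h⟩ := single_eq_of_signs i j
  rw [h]
  have hmem : ∀ {a b}, IsSign a → IsSign b →
      (fun i j => a i * b j) ∈ affineSpan ℝ (correlationPolytope mA mB) := fun ha hb =>
    subset_affineSpan ℝ _ (signPoints_subset ⟨_, _, ha, hb, rfl⟩)
  exact Submodule.smul_mem _ _ (Submodule.sub_mem _
    (AffineSubspace.vsub_mem_direction (hmem ha hb) (hmem ha' hb))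
    (AffineSubspace.vsub_mem_direction (hmem ha hb') (hmem ha' hb')))

theorem affineDim_correlationPolytope :
    affineDim (correlationPolytope mA mB) = Module.finrank ℝ (Fin mA → Fin mB → ℝ) := by
  rw [affineDim, direction_affineSpan_correlationPolytope, finrank_top]

theorem affineDim_mono {S T : Set (Fin mA → Fin mB → ℝ)} (h : S ⊆ T) :
    affineDim S ≤ affineDim T :=
  Submodule.finrank_mono (AffineSubspace.direction_le (affineSpan_mono ℝ h))

theorem direction_face_le_ker (K : Set (Fin mA → Fin mB → ℝ)) (α : Fin mA → Fin mB → ℝ) (β : ℝ) :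
    (affineSpan ℝ (face K α β)).direction ≤ LinearMap.ker (bellLin α) := by
  rw [direction_affineSpan, vectorSpan_def, Submodule.span_le]
  rintro _ ⟨x, hx, y, hy, rfl⟩
  simp only [vsub_eq_sub, SetLike.mem_coe, LinearMap.mem_ker, map_sub, bellLin_apply, hx.2, hy.2,
    sub_self]

theorem affineDim_face_lt {K : Set (Fin mA → Fin mB → ℝ)} {α : Fin mA → Fin mB → ℝ} {β : ℝ}
    (hβ : β ≠ 0) (hne : (face K α β).Nonempty) :
    affineDim (face K α β) < Module.finrank ℝ (Fin mA → Fin mB → ℝ) := by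
  refine Submodule.finrank_lt fun htop => ?_
  obtain ⟨x, -, hx⟩ := hne
  have : x ∈ LinearMap.ker (bellLin α) := direction_face_le_ker K α β (htop ▸ Submodule.mem_top)
  exact hβ (hx ▸ this)

/-- The deterministic points at which a Bell expression has the value `β`. -/
def tightPoints (α : Fin mA → Fin mB → ℝ) (β : ℝ) : Set (Fin mA → Fin mB → ℝ) :=
  {x | x ∈ signPoints mA mB ∧ bellValue α x = β}

theorem face_subset_span {α : Fin mA → Fin mB → ℝ} {β : ℝ}
    (hval : ∀ x ∈ correlationPolytope mA mB, bellValue α x ≤ β) :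
    face (correlationPolytope mA mB) α β ⊆ Submodule.span ℝ (tightPoints α β) := by
  -- With both weights positive, equality at a convex combination forces equality at both endpoints.
  have hconv : Convex ℝ {x | bellLin α x ≤ β ∧
      (bellLin α x = β → x ∈ Submodule.span ℝ (tightPoints α β))} := by
    rw [convex_iff_forall_pos]
    rintro x ⟨hx, hx'⟩ y ⟨hy, hy'⟩ s t hs ht hst
    obtain rfl : s = 1 - t := by linarith
    simp only [Set.mem_ofPred_eq, map_add, map_smul, smul_eq_mul]
    refine ⟨by nlinarith, fun h => ?_⟩
    exact Submodule.add_mem _ (Submodule.smul_mem _ _ (hx' (by nlinarith)))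
      (Submodule.smul_mem _ _ (hy' (by nlinarith)))
  rintro x ⟨hx, hxβ⟩
  rw [correlationPolytope_eq] at hx
  refine (convexHull_min ?_ hconv hx).2 hxβ
  exact fun y hy => ⟨hval y (signPoints_subset hy), fun h => Submodule.subset_span ⟨hy, h⟩⟩

/-- Replacing `a` by `-a` negates the Bell value, so the bound `0` would make the face the whole
polytope. -/
theorem IsFacetDefining.bound_ne_zero {α : Fin mA → Fin mB → ℝ} {β : ℝ}
    (h : IsFacetDefining (correlationPolytope mA mB) α β) : β ≠ 0 := by
  rintro rfl
  obtain ⟨hval, -, hdim⟩ := h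
  have hzero : ∀ x ∈ signPoints mA mB, bellLin α x = 0 := by
    rintro _ ⟨a, b, ha, hb, rfl⟩
    refine le_antisymm (hval _ (signPoints_subset ⟨a, b, ha, hb, rfl⟩)) ?_
    have h := hval _ (signPoints_subset ⟨_, b, ha.neg, hb, rfl⟩)
    have h' : (fun i j => -a i * b j) = -(fun i j => a i * b j : Fin mA → Fin mB → ℝ) := by
      ext; simp
    rw [h', ← bellLin_apply, map_neg] at h
    linarith
  have hface : face (correlationPolytope mA mB) α 0 = correlationPolytope mA mB := by
    refine Set.Subset.antisymm (fun x hx => hx.1) fun x hx => ⟨hx, ?_⟩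
    rw [correlationPolytope_eq] at hx
    exact convexHull_min (t := {y | bellLin α y = 0}) hzero (LinearMap.ker (bellLin α)).convex hx
  rw [hface] at hdim
  omega

/-- The direction of the facet is a hyperplane inside the kernel of the Bell functional, while
points of the facet have value `β ≠ 0`; adding one of them gains the missing dimension. -/
theorem IsFacetDefining.span_tightPoints_eq_top {α : Fin mA → Fin mB → ℝ} {β : ℝ}
    (h : IsFacetDefining (correlationPolytope mA mB) α β) :
    Submodule.span ℝ (tightPoints α β) = ⊤ := by
  obtain ⟨hval, ⟨x, hx⟩, hdim⟩ := id h
  have hle : (affineSpan ℝ (face (correlationPolytope mA mB) α β)).direction ≤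
      Submodule.span ℝ (tightPoints α β) := by
    rw [direction_affineSpan, vectorSpan_def, Submodule.span_le]
    rintro _ ⟨y, hy, z, hz, rfl⟩
    exact Submodule.sub_mem _ (face_subset_span hval hy) (face_subset_span hval hz)
  have hlt := Submodule.finrank_lt_finrank_of_lt (lt_of_le_of_ne hle fun heq =>
    h.bound_ne_zero (hx.2 ▸ direction_face_le_ker _ α β (heq ▸ face_subset_span hval hx)))
  refine Submodule.eq_top_of_finrank_eq (le_antisymm (Submodule.finrank_le _) ?_)
  rw [affineDim_correlationPolytope, affineDim] at hdim
  omega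

/-- A Bell expression that vanishes at all tight points of a facet is zero. -/
theorem IsFacetDefining.eq_zero {α γ : Fin mA → Fin mB → ℝ} {β : ℝ}
    (h : IsFacetDefining (correlationPolytope mA mB) α β)
    (hγ : ∀ a b, IsSign a → IsSign b → (∑ i, ∑ j, α i j * (a i * b j) = β) →
      ∑ i, ∑ j, γ i j * (a i * b j) = 0) (i : Fin mA) (j : Fin mB) : γ i j = 0 := by
  have hle : Submodule.span ℝ (tightPoints α β) ≤ LinearMap.ker (bellLin γ) := by
    rw [Submodule.span_le]
    rintro _ ⟨⟨a, b, ha, hb, rfl⟩, hβ⟩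
    exact hγ a b ha hb hβ
  rw [h.span_tightPoints_eq_top] at hle
  have := hle (Submodule.mem_top (x := Pi.single i (Pi.single j 1)))
  simpa [bellValue, Pi.single_apply, apply_ite, ite_apply] using this

theorem IsFacetDefining.of_single_entry {α : Fin mA → Fin mB → ℝ} {β : ℝ}
    (h : IsFacetDefining (correlationPolytope mA mB) α β) {i₀ : Fin mA} {j₀ : Fin mB}
    (hα : ∀ i j, α i j ≠ 0 → i = i₀ ∧ j = j₀) :
    IsFacetDefining (noSignallingCorrelations mA mB) α β := by
  have hβ := h.bound_ne_zero
  obtain ⟨hval, hne, hdim⟩ := h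
  have hsub : face (correlationPolytope mA mB) α β ⊆ face (noSignallingCorrelations mA mB) α β :=
    fun x hx => ⟨correlationPolytope_subset hx.1, hx.2⟩
  have hbell : ∀ x, bellValue α x = α i₀ j₀ * x i₀ j₀ := by
    intro x
    rw [bellValue, Finset.sum_eq_single i₀ _ (by simp), Finset.sum_eq_single j₀ _ (by simp)]
    · intro j _ hj
      rw [by_contra fun h => hj (hα i₀ j h).2, zero_mul]
    · intro i _ hi
      refine Finset.sum_eq_zero fun j _ => ?_
      rw [by_contra fun h => hi (hα i j h).1, zero_mul]
  refine ⟨?_, hne.mono hsub, ?_⟩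
  · rintro _ ⟨P, hP, rfl⟩
    have h1 := hval _ (signPoints_subset
      ⟨fun _ => 1, fun _ => 1, fun _ => .inl rfl, fun _ => .inl rfl, rfl⟩)
    have h2 := hval _ (signPoints_subset
      ⟨fun _ => -1, fun _ => 1, fun _ => .inr rfl, fun _ => .inl rfl, rfl⟩)
    rw [hbell] at h1 h2 ⊢
    have h3 := abs_correlators_le_one (hP.1 i₀ j₀) (hP.2.1 i₀ j₀)
    calc α i₀ j₀ * correlators P i₀ j₀ ≤ |α i₀ j₀| * |correlators P i₀ j₀| :=
          (le_abs_self _).trans (abs_mul _ _).le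
      _ ≤ |α i₀ j₀| := mul_le_of_le_one_right (abs_nonneg _) h3
      _ ≤ β := abs_le'.2 ⟨by linarith, by linarith⟩
  -- The larger face contains one of codimension one and is itself not full-dimensional, because `β
  -- ≠ 0`.
  · have h1 := affineDim_face_lt hβ (hne.mono hsub)
    have h2 := affineDim_mono hsub
    have h3 := affineDim_mono (correlationPolytope_subset (mA := mA) (mB := mB))
    have h4 : affineDim (noSignallingCorrelations mA mB) ≤ _ := Submodule.finrank_le _
    rw [affineDim_correlationPolytope] at hdim h3
    omega

/-! ### Bell expressions without quantum violation -/

theorem sum_mul_signs_eq (α : Fin mA → Fin mB → ℝ) (a : Fin mA → ℝ) (b : Fin mB → ℝ) :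
    ∑ i, ∑ j, α i j * (a i * b j) = ∑ j, (∑ i, α i j * a i) * b j := by
  rw [Finset.sum_comm]
  exact Finset.sum_congr rfl fun j _ => by
    rw [Finset.sum_mul]
    exact Finset.sum_congr rfl fun i _ => by ring

theorem exists_isSign_mul_eq_abs {n : ℕ} (s : Fin n → ℝ) :
    ∃ b : Fin n → ℝ, IsSign b ∧ ∀ j, s j * b j = |s j| := by
  refine ⟨fun j => if 0 ≤ s j then 1 else -1, fun j => ?_, fun j => ?_⟩
  · by_cases h : 0 ≤ s j <;> simp [h]
  · by_cases h : 0 ≤ s j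
    · simp [h, abs_of_nonneg h]
    · simp [h, abs_of_neg (not_le.1 h)]

theorem mul_eq_abs_of_sum_eq {n : ℕ} {s b : Fin n → ℝ} (hb : IsSign b)
    (h : ∑ j, |s j| ≤ ∑ j, s j * b j) (j : Fin n) : s j * b j = |s j| := by
  have hle : ∀ j ∈ Finset.univ, s j * b j ≤ |s j| := fun j _ => by
    rcases hb j with h | h <;> rw [h]
    · simpa using le_abs_self (s j)
    · simpa using neg_le_abs (s j)
  exact (Finset.sum_eq_sum_iff_of_le hle).1 (le_antisymm (Finset.sum_le_sum hle) h) j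
    (Finset.mem_univ j)

/-- Choosing Bob's answers optimally for Alice's answers `a`. -/
theorem sum_abs_le {α : Fin mA → Fin mB → ℝ} {β : ℝ}
    (hval : ∀ x ∈ correlationPolytope mA mB, bellValue α x ≤ β) {a : Fin mA → ℝ} (ha : IsSign a) :
    ∑ j, |∑ i, α i j * a i| ≤ β := by
  obtain ⟨b, hb, h⟩ := exists_isSign_mul_eq_abs fun j => ∑ i, α i j * a i
  have := hval _ (signPoints_subset ⟨a, b, ha, hb, rfl⟩)
  rw [bellValue, sum_mul_signs_eq] at this
  simpa only [h] using this

/-- Superposing two deterministic strategies of Alice with equal weights, and choosing Bob's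
measurements optimally. -/
theorem sum_sqrt_le {α : Fin mA → Fin mB → ℝ} {β : ℝ}
    (hq : ∀ x ∈ quantumCorrelations mA mB, bellValue α x ≤ β) {a a' : Fin mA → ℝ}
    (ha : IsSign a) (ha' : IsSign a') :
    ∑ j, √(((∑ i, α i j * a i) ^ 2 + (∑ i, α i j * a' i) ^ 2) / 2) ≤ β := by
  have hopt : ∀ p q : ℝ, ∃ v v' : ℝ, v * v + v' * v' = 1 ∧
      (p * v + q * v') * √(1 / 2) = √((p ^ 2 + q ^ 2) / 2) := by
    intro p q
    rcases eq_or_ne (p ^ 2 + q ^ 2) 0 with h | h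
    -- When the vector to align with is zero, any unit vector serves.
    · obtain rfl : p = 0 := by nlinarith [sq_nonneg p, sq_nonneg q]
      obtain rfl : q = 0 := by nlinarith [sq_nonneg q]
      exact ⟨1, 0, by norm_num, by simp⟩
    · have hpos : 0 ≤ p ^ 2 + q ^ 2 := by positivity
      have hs : √(p ^ 2 + q ^ 2) ≠ 0 := by positivity
      have hs2 := Real.sq_sqrt hpos
      refine ⟨p / √(p ^ 2 + q ^ 2), q / √(p ^ 2 + q ^ 2), ?_, ?_⟩
      · field_simp
        exact hs2.symm
      · rw [div_eq_mul_one_div (p ^ 2 + q ^ 2) 2, Real.sqrt_mul hpos]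
        congr 1
        field_simp
        exact hs2.symm
  choose v v' hv hvv using fun j => hopt (∑ i, α i j * a i) (∑ i, α i j * a' i)
  have hr : √(1 / 2 : ℝ) * √(1 / 2) = 1 / 2 := Real.mul_self_sqrt (by norm_num)
  have := hq _ (inner_mem_quantumCorrelations (u := fun i => √(1 / 2) * a i)
    (u' := fun i => √(1 / 2) * a' i) (fun i => by
      linear_combination (a i * a i + a' i * a' i) * hr + 1 / 2 * ha.mul_self i +
        1 / 2 * ha'.mul_self i) hv)
  refine le_of_eq_of_le ?_ this
  rw [bellValue, Finset.sum_comm]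
  refine Finset.sum_congr rfl fun j _ => ?_
  rw [← hvv j, Finset.sum_mul, Finset.sum_mul, ← Finset.sum_add_distrib, Finset.sum_mul]
  exact Finset.sum_congr rfl fun i _ => by ring

theorem mean_abs_le_sqrt (p q : ℝ) : (|p| + |q|) / 2 ≤ √((p ^ 2 + q ^ 2) / 2) := by
  refine Real.le_sqrt_of_sq_le ?_
  nlinarith [sq_nonneg (|p| - |q|), sq_abs p, sq_abs q]

theorem abs_eq_of_mean_abs_eq_sqrt {p q : ℝ} (h : (|p| + |q|) / 2 = √((p ^ 2 + q ^ 2) / 2)) :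
    |p| = |q| := by
  have h2 := Real.sq_sqrt (show 0 ≤ (p ^ 2 + q ^ 2) / 2 by positivity)
  rw [← h] at h2
  have : (|p| - |q|) ^ 2 = 0 := by nlinarith [sq_abs p, sq_abs q]
  exact sub_eq_zero.1 (pow_eq_zero_iff two_ne_zero |>.1 this)

/-- Without quantum violation, Bob's answers at the tight points depend linearly on Alice's. -/
theorem exists_column_multipliers {α : Fin mA → Fin mB → ℝ} {β : ℝ}
    (hval : ∀ x ∈ correlationPolytope mA mB, bellValue α x ≤ β)
    (hq : ∀ x ∈ quantumCorrelations mA mB, bellValue α x ≤ β) :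
    ∃ l : Fin mB → ℝ, ∀ a b, IsSign a → IsSign b → (∑ i, ∑ j, α i j * (a i * b j) = β) →
      ∀ j, ∑ i, α i j * a i = l j * b j := by
  by_cases hex : ∃ a b, IsSign a ∧ IsSign b ∧ ∑ i, ∑ j, α i j * (a i * b j) = β
  swap
  · exact ⟨0, fun a b ha hb h => (hex ⟨a, b, ha, hb, h⟩).elim⟩
  obtain ⟨a₀, b₀, ha₀, hb₀, h₀⟩ := hex
  have habs : ∀ a b, IsSign a → IsSign b → (∑ i, ∑ j, α i j * (a i * b j) = β) →
      ∀ j, (∑ i, α i j * a i) * b j = |∑ i, α i j * a i| := by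
    intro a b ha hb h
    refine mul_eq_abs_of_sum_eq (s := fun j => ∑ i, α i j * a i) hb ?_
    rw [← sum_mul_signs_eq, h]
    exact sum_abs_le hval ha
  refine ⟨fun j => |∑ i, α i j * a₀ i|, fun a b ha hb h j => ?_⟩
  have hsum : ∑ j, (|∑ i, α i j * a₀ i| + |∑ i, α i j * a i|) / 2 = β := by
    rw [← Finset.sum_div, Finset.sum_add_distrib]
    simp only [← habs a b ha hb h, ← habs a₀ b₀ ha₀ hb₀ h₀]
    rw [← sum_mul_signs_eq, ← sum_mul_signs_eq, h, h₀]
    ring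
  -- The means sum to `β` and the root mean squares to at most `β`, so every termwise inequality is
  -- an equality.
  have hle := fun j (_ : j ∈ Finset.univ) =>
    mean_abs_le_sqrt (∑ i, α i j * a₀ i) (∑ i, α i j * a i)
  have heq := (Finset.sum_eq_sum_iff_of_le hle).1 (le_antisymm (Finset.sum_le_sum hle)
    ((sum_sqrt_le hq ha₀ ha).trans hsum.ge)) j (Finset.mem_univ j)
  simp only [abs_eq_of_mean_abs_eq_sqrt heq, ← habs a b ha hb h, mul_assoc, hb.mul_self, mul_one]

theorem IsFacetDefining.column_unique {α : Fin mA → Fin mB → ℝ} {β : ℝ}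
    (h : IsFacetDefining (correlationPolytope mA mB) α β)
    (hq : ∀ x ∈ quantumCorrelations mA mB, bellValue α x ≤ β)
    {i i' : Fin mA} {j j' : Fin mB} (hα : α i j ≠ 0) (hα' : α i' j' ≠ 0) : j = j' := by
  obtain ⟨l, hl⟩ := exists_column_multipliers h.1 hq
  by_contra hne
  have hl' : l j' ≠ 0 := by
    intro h0
    -- If `l j' = 0`, column `j'` of `α` alone is a functional vanishing at all tight points.
    have := h.eq_zero (γ := fun i k => if k = j' then α i j' else 0) (fun a b ha hb hab => by
      simp only [sum_mul_signs_eq]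
      refine Finset.sum_eq_zero fun k _ => ?_
      by_cases hk : k = j'
      · simp [hk, hl a b ha hb hab j', h0]
      · simp [hk]) i' j'
    simp only [if_true] at this
    exact hα' this
  -- Column `j` is placed at `j'` and vice versa: at tight points both terms equal `l j * l j' * b j
  -- * b j'`. The entry `(i, j')` of this functional is `l j' * α i j`.
  have := h.eq_zero (γ := fun i k => (if k = j' then l j' * α i j else 0) -
      if k = j then l j * α i j' else 0) (fun a b ha hb hab => by
    have hcol := hl a b ha hb hab
    have hcol' : ∀ c k k', ∑ i, ∑ m, (if m = k then c * α i k' else 0) * (a i * b m) =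
        c * (l k' * b k') * b k := fun c k k' => by
      simp only [ite_mul, zero_mul, Finset.sum_ite_eq', Finset.mem_univ, if_true]
      rw [← hcol, Finset.mul_sum, Finset.sum_mul]
      exact Finset.sum_congr rfl fun i _ => by ring
    simp only [sub_mul, Finset.sum_sub_distrib, hcol']
    ring) i j'
  simp only [if_true, Ne.symm hne, if_false, sub_zero] at this
  exact mul_ne_zero hl' hα this

theorem IsFacetDefining.row_unique {α : Fin mA → Fin mB → ℝ} {β : ℝ}
    (h : IsFacetDefining (correlationPolytope mA mB) α β) {j : Fin mB}
    (hcol : ∀ i k, α i k ≠ 0 → k = j) {i i' : Fin mA} (hα : α i j ≠ 0) (hα' : α i' j ≠ 0) :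
    i = i' := by
  by_contra hne
  have hsum : ∀ γ : Fin mA → Fin mB → ℝ, (∀ i k, k ≠ j → γ i k = 0) → ∀ (a : Fin mA → ℝ)
      (b : Fin mB → ℝ), ∑ i, ∑ k, γ i k * (a i * b k) = ∑ i, γ i j * (a i * b j) := by
    intro γ hγ a b
    refine Finset.sum_congr rfl fun i _ => Finset.sum_eq_single j (fun k _ hk => ?_) (by simp)
    rw [hγ i k hk, zero_mul]
  have hα0 : ∀ i k, k ≠ j → α i k = 0 := fun i k hk => by_contra fun h => hk (hcol i k h)
  obtain ⟨a₁, ha₁, h₁⟩ := exists_isSign_mul_eq_abs fun i => α i j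
  have hβ : ∑ i, |α i j| ≤ β := by
    have := h.1 _ (signPoints_subset ⟨a₁, fun _ => 1, ha₁, fun _ => .inl rfl, rfl⟩)
    rw [bellValue, hsum α hα0] at this
    simpa [h₁] using this
  -- With one column, tightness means `α m j * (a m * b j) = |α m j|` for each `m`, so after
  -- cross-weighting the terms of rows `i` and `i'` cancel.
  have := h.eq_zero (γ := fun m k => if k = j then ((if m = i then |α i' j| * α i j else 0) -
      if m = i' then |α i j| * α i' j else 0) else 0) (fun a b ha hb hab => by
    have htight : ∀ m, α m j * (a m * b j) = |α m j| := by
      refine mul_eq_abs_of_sum_eq (s := fun m => α m j) (b := fun m => a m * b j) (fun m => ?_) ?_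
      · rcases ha m with h | h <;> rcases hb j with h' | h' <;> simp [h, h']
      · rw [← hsum α hα0, hab]
        exact hβ
    rw [hsum _ (fun m k hk => by simp [hk])]
    simp only [if_true, sub_mul, Finset.sum_sub_distrib, ite_mul, zero_mul, Finset.sum_ite_eq',
      Finset.mem_univ, mul_assoc, htight]
    ring) i j
  simp only [if_true, hne, if_false, sub_zero] at this
  exact mul_ne_zero (abs_ne_zero.2 hα') hα this

end BellCorr

open BellCorr in
theorem mainTheorem3 (mA mB : ℕ) (α : Fin mA → Fin mB → ℝ) (βc : ℝ)
    (hfacet : BellCorr.IsFacetDefining (BellCorr.correlationPolytope mA mB) α βc)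
    (hproper : ¬ BellCorr.IsFacetDefining (BellCorr.noSignallingCorrelations mA mB) α βc) :
    ∃ βq : ℝ, IsLUB (BellCorr.quantumValues α) βq ∧ βc < βq := by
  have hne : (quantumValues α).Nonempty :=
    ⟨_, _, inner_mem_quantumCorrelations (u := fun _ => 1) (u' := fun _ => 0) (v := fun _ => 1)
      (v' := fun _ => 0) (fun _ => by norm_num) (fun _ => by norm_num), rfl⟩
  have hlub := isLUB_csSup hne (bddAbove_quantumValues α)
  refine ⟨_, hlub, lt_of_not_ge fun hle => hproper ?_⟩
  have hq : ∀ x ∈ quantumCorrelations mA mB, bellValue α x ≤ βc := fun x hx =>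
    (hlub.1 ⟨x, hx, rfl⟩).trans hle
  obtain ⟨i₀, j₀, h₀⟩ : ∃ i j, α i j ≠ 0 := by
    by_contra! h0
    obtain ⟨x, -, hx⟩ := hfacet.2.1
    exact hfacet.bound_ne_zero (by simp [← hx, bellValue, h0])
  have hcol : ∀ i j, α i j ≠ 0 → j = j₀ := fun i j h => hfacet.column_unique hq h h₀
  refine hfacet.of_single_entry (i₀ := i₀) (j₀ := j₀) fun i j h => ?_
  obtain rfl := hcol i j h
  exact ⟨hfacet.row_unique hcol h h₀, rfl⟩
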